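/- Let $\alpha\in(0,1)$ and $t_0<t_1$ be real numbers. For $\beta>0$ put $g_\beta(t)=t^{\beta-1}/\Gamma(\beta)$ if $t>0$ and $g_\beta(t)=0$ if $t\le 0$, and for $h:[t_0,t_1]\to\mathbb{R}$ let $g_\beta*h$ denote the convolution of $g_\beta$ with the extension of $h$ by zero outside $[t_0,t_1]$. Let $f:[t_0,t_1]\to\mathbb{R}$ be continuous and such that $g_{1-\alpha}*f$ and $g_{1-\alpha}*f^2$ belong to the Sobolev space $W^{1,1}(t_0,t_1;\mathbb{R})$. For $h\in\{f,f^2\}$ the Caputo fractional derivative of order $\alpha$ at $t_0$, $$cD_{t_0,t}^\alpha h(t):=\frac{d}{dt}\Big[g_{1-\alpha}*\big(h-h(t_0)\big)\Big](t)\qquad(\text{weak derivative on }(t_0,t_1)),$$ is then a well-defined element of $L^1(t_0,t_1;\mathbb{R})$, that is, $g_{1-\alpha}*(h-h(t_0))\in W^{1,1}(t_0,t_1;\mathbb{R})$, and $$cD_{t_0,t}^\alpha\big[f(t)\big]^2\le 2\,\big[cD_{t_0,t}^\alpha f(t)\big]\,f(t)\qquad\text{for almost every }t\in[t_0,t_1].$$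 -/

import Mathlib

open Set MeasureTheory
open scoped Convolution ContDiff

noncomputable section

/-- The Gel'fand–Shilov kernel: `g_β(t) = t^(β-1) / Γ(β)` for `t > 0`, and `0` for `t ≤ 0`. -/
def gelfandShilov (β : ℝ) (t : ℝ) : ℝ :=
  if 0 < t then t ^ (β - 1) / Real.Gamma β else 0

/-- The convolution `g_β * f` on `ℝ`, where `f` is extended by zero outside `[a, b]`. -/
def kernelConv (β a b : ℝ) (f : ℝ → ℝ) : ℝ → ℝ :=
  gelfandShilov β ⋆[ContinuousLinearMap.mul ℝ ℝ, volume] (Icc a b).indicator f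

/-- `v ∈ L¹(a, b)` is a weak derivative of `u ∈ L¹(a, b)` on the open interval `(a, b)`. -/
structure HasWeakDerivL1 (a b : ℝ) (u v : ℝ → ℝ) : Prop where
  integrableOn : IntegrableOn u (Ioo a b)
  integrableOn_deriv : IntegrableOn v (Ioo a b)
  integral_eq : ∀ φ : ℝ → ℝ, ContDiff ℝ ∞ φ → HasCompactSupport φ → tsupport φ ⊆ Ioo a b →
    ∫ t in Ioo a b, u t * deriv φ t = - ∫ t in Ioo a b, v t * φ t

/-- The Sobolev space `W^{1,1}(a, b)`. -/
def MemW11 (a b : ℝ) (u : ℝ → ℝ) : Prop :=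
  ∃ v : ℝ → ℝ, HasWeakDerivL1 a b u v

open Classical in
/-- A representative of the weak derivative of `u ∈ W^{1,1}(a, b)`; it is determined up to
equality almost everywhere on `(a, b)`, see `HasWeakDerivL1.ae_eq`. (Zero off `W^{1,1}`.) -/
def weakDeriv (a b : ℝ) (u : ℝ → ℝ) : ℝ → ℝ :=
  if h : MemW11 a b u then h.choose else 0

/-- The Riemann–Liouville fractional derivative of order `α ∈ (0, 1)` at `a`: the weak derivative
on `(a, b)` of `g_{1-α} * f`. -/
def riemannLiouvilleDeriv (α a b : ℝ) (f : ℝ → ℝ) : ℝ → ℝ :=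
  weakDeriv a b (kernelConv (1 - α) a b f)

/-- The Caputo fractional derivative of order `α ∈ (0, 1)` at `a`: the Riemann–Liouville
derivative of `f - f(a)`. -/
def caputoDeriv (α a b : ℝ) (f : ℝ → ℝ) : ℝ → ℝ :=
  riemannLiouvilleDeriv α a b (fun t => f t - f a)

theorem MemW11.hasWeakDerivL1_weakDeriv {a b : ℝ} {u : ℝ → ℝ} (h : MemW11 a b u) :
    HasWeakDerivL1 a b u (weakDeriv a b u) := by
  rw [weakDeriv, dif_pos h]
  exact h.choose_spec

/-- Weak derivatives are unique up to equality almost everywhere. -/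
theorem HasWeakDerivL1.ae_eq {a b : ℝ} {u v w : ℝ → ℝ}
    (hv : HasWeakDerivL1 a b u v) (hw : HasWeakDerivL1 a b u w) :
    v =ᵐ[volume.restrict (Ioo a b)] w := by
  have hd : IntegrableOn (fun t => v t - w t) (Ioo a b) :=
    hv.integrableOn_deriv.sub hw.integrableOn_deriv
  have key := isOpen_Ioo.ae_eq_zero_of_integral_contDiff_smul_eq_zero (U := Ioo a b)
    (μ := volume) hd.locallyIntegrableOn (fun φ hφ hc hs => by
      have hcont : Continuous φ := hφ.continuous
      have hb : ∃ C, ∀ x, ‖φ x‖ ≤ C := hc.exists_bound_of_continuous hcont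
      obtain ⟨C, hC⟩ := hb
      have iv : IntegrableOn (fun t => v t * φ t) (Ioo a b) :=
        hv.integrableOn_deriv.mul_bdd (c := C) hcont.aestronglyMeasurable
          (Filter.Eventually.of_forall hC)
      have iw : IntegrableOn (fun t => w t * φ t) (Ioo a b) :=
        hw.integrableOn_deriv.mul_bdd (c := C) hcont.aestronglyMeasurable
          (Filter.Eventually.of_forall hC)
      have e := (hv.integral_eq φ hφ hc hs).symm.trans (hw.integral_eq φ hφ hc hs)
      have hsupp : ∀ x, x ∉ Ioo a b → φ x • (v x - w x) = 0 := fun x hx => by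
        have : φ x = 0 := image_eq_zero_of_notMem_tsupport (fun h => hx (hs h))
        simp [this]
      rw [← setIntegral_eq_integral_of_forall_compl_eq_zero hsupp]
      have : ∀ x, φ x • (v x - w x) = v x * φ x - w x * φ x := fun x => by
        simp only [smul_eq_mul]; ring
      simp_rw [this]
      rw [integral_sub iv iw]
      linarith)
  rw [Filter.EventuallyEq, ae_restrict_iff' measurableSet_Ioo]
  filter_upwards [key] with x hx hxm
  linarith [hx hxm]

end

open Filter Topology

/-! For a kernel `k` that is `C¹` up to `0`, nonnegative and nonincreasing, the inequality is
elementary: with `q = -k' ≥ 0` the derivative of `k * u` at `t` is `k(0) u(t) - ∫ q(ρ) u(t - ρ) dρ`,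
and `2 u (k * u)' - (k * u²)'` equals `∫ q(ρ) (u(t) - u(t - ρ))² dρ + (k(0) - ∫ q) u(t)²`, where `∫
q ≤ k(0)` (`regularized_sq_le`). The kernel `g_{1-α}` is singular at `0`, so it is convolved with
the gamma density `γ_n` of shape `α` and rate `n`. The result `k_n` is a mixture of the exponentials
`exp (-nρx)` with `x` beta distributed (`convolution_gammaPDFReal_truncKernel`), hence smooth and
nonincreasing. If `v` is the weak derivative of `g_{1-α} * u`, then `γ_n * v` is the derivative of
`k_n * u` (`convolution_gammaPDFReal_weakDeriv_ae_eq`); no boundary term appears because `g_{1-α} *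
u` tends to `0` at the left endpoint. As `n → ∞`, `γ_n` tends to the Dirac mass, and the inequality
passes to the limit against nonnegative test functions (`weakDeriv_kernelConv_sq_le`). This is
applied to `u = f - f(t₀)`; expanding the square gives the claim for `f`. -/

/-! ### Convolutions paired with test functions. -/

theorem integral_convolution_mul_eq {A B ψ : ℝ → ℝ} (hA : Integrable A) (hB : Integrable B)
    (hψ : Continuous ψ) {C : ℝ} (hC : ∀ x, ‖ψ x‖ ≤ C) :
    ∫ t, (A ⋆[ContinuousLinearMap.mul ℝ ℝ, volume] B) t * ψ t
      = ∫ s, A s * ∫ τ, B τ * ψ (s + τ) := by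
  have h1 := hA.convolution_integrand (ContinuousLinearMap.mul ℝ ℝ) hB
  have h2 : Integrable (fun p : ℝ × ℝ => A p.2 * B (p.1 - p.2) * ψ p.1)
      (volume.prod volume) :=
    h1.mul_bdd (c := C) (hψ.comp continuous_fst).aestronglyMeasurable
      (Eventually.of_forall fun p => hC p.1)
  simp only [convolution_def, ContinuousLinearMap.mul_apply', ← integral_mul_const]
  rw [integral_integral_swap h2]
  congr 1 with s
  rw [← integral_add_left_eq_self _ s, ← integral_const_mul]
  congr 1 with τ
  simp [mul_assoc]

theorem integral_convolution_mul_eq' {A B ψ : ℝ → ℝ} (hA : Integrable A) (hB : Integrable B)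
    (hψ : Continuous ψ) {C : ℝ} (hC : ∀ x, ‖ψ x‖ ≤ C) :
    ∫ t, (A ⋆[ContinuousLinearMap.mul ℝ ℝ, volume] B) t * ψ t
      = ∫ s, B s * ∫ τ, A τ * ψ (s + τ) := by
  rw [← integral_convolution_mul_eq hB hA hψ hC]
  congr 1 with t
  rw [convolution_mul_swap, convolution_mul]
  simp only [mul_comm]

/-! ### The truncated kernel and the behaviour of the fractional integral at the left endpoint. -/

/-- The Gel'fand–Shilov kernel restricted to `(0, R)`. -/
noncomputable def truncKernel (β R : ℝ) : ℝ → ℝ := (Ioo 0 R).indicator (gelfandShilov β)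

theorem truncKernel_of_nonpos (β R : ℝ) {t : ℝ} (ht : ¬ 0 < t) : truncKernel β R t = 0 :=
  indicator_of_notMem (fun h => ht h.1) _

theorem truncKernel_of_mem (β : ℝ) {R t : ℝ} (ht : t ∈ Ioo 0 R) :
    truncKernel β R t = t ^ (β - 1) / Real.Gamma β := by
  rw [truncKernel, indicator_of_mem ht, gelfandShilov, if_pos ht.1]

theorem truncKernel_nonneg {β : ℝ} (hβ : 0 < β) (R t : ℝ) : 0 ≤ truncKernel β R t := by
  unfold truncKernel
  refine indicator_nonneg (fun x hx => ?_) t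
  rw [gelfandShilov, if_pos hx.1]
  exact div_nonneg (Real.rpow_nonneg hx.1.le _) (Real.Gamma_pos_of_pos hβ).le

theorem integrable_truncKernel {β : ℝ} (hβ : 0 < β) (R : ℝ) : Integrable (truncKernel β R) := by
  unfold truncKernel
  rw [integrable_indicator_iff measurableSet_Ioo]
  rcases le_or_gt R 0 with hR | hR
  · simp [Ioo_eq_empty_of_le hR]
  have h : IntervalIntegrable (fun t : ℝ => t ^ (β - 1) / Real.Gamma β) volume 0 R :=
    (intervalIntegral.intervalIntegrable_rpow' (by linarith)).div_const _
  rw [intervalIntegrable_iff_integrableOn_Ioo_of_le hR.le] at h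
  refine h.congr_fun (fun t ht => ?_) measurableSet_Ioo
  simp [gelfandShilov, ht.1]

/-- Only `τ ≤ t - a < b - a` contributes. The truncated kernel is integrable on the whole line, so
Fubini applies to it. -/
theorem kernelConv_eq_convolution_truncKernel (β : ℝ) {a b t : ℝ} (htb : t < b) (f : ℝ → ℝ) :
    kernelConv β a b f t
      = (truncKernel β (b - a) ⋆[ContinuousLinearMap.mul ℝ ℝ, volume] (Icc a b).indicator f) t := by
  simp only [kernelConv, convolution_def, ContinuousLinearMap.mul_apply']
  congr 1 with τ
  by_cases h : t - τ ∈ Icc a b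
  · by_cases h0 : 0 < τ
    · rw [truncKernel_of_mem β ⟨h0, by linarith [h.1]⟩, gelfandShilov, if_pos h0]
    · rw [truncKernel_of_nonpos _ _ h0, gelfandShilov, if_neg h0]
  · simp [h]

theorem convolution_truncKernel_of_le (β : ℝ) {a b t : ℝ} (hta : t ≤ a) (f : ℝ → ℝ) :
    (truncKernel β (b - a) ⋆[ContinuousLinearMap.mul ℝ ℝ, volume] (Icc a b).indicator f) t = 0 := by
  simp only [convolution_def, ContinuousLinearMap.mul_apply']
  refine integral_eq_zero_of_ae (Eventually.of_forall fun τ => ?_)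
  by_cases h0 : 0 < τ
  · have h : t - τ ∉ Icc a b := fun h => by linarith [h.1]
    simp [h]
  · simp [truncKernel_of_nonpos _ _ h0]

theorem tendsto_kernelConv_nhdsGT {β : ℝ} (hβ : 0 < β) {a b : ℝ} (hab : a < b) {f : ℝ → ℝ} {M : ℝ}
    (hM : ∀ t ∈ Icc a b, ‖f t‖ ≤ M) :
    Tendsto (kernelConv β a b f) (𝓝[>] a) (𝓝 0) := by
  have hM0 : 0 ≤ M := (norm_nonneg _).trans (hM a ⟨le_rfl, hab.le⟩)
  have hG := integrable_truncKernel hβ (b - a)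
  have hlim : Tendsto (fun t => M * ∫ τ in (0 : ℝ)..(t - a), truncKernel β (b - a) τ)
      (𝓝[>] a) (𝓝 0) := by
    have hc : Continuous fun t => M * ∫ τ in (0 : ℝ)..(t - a), truncKernel β (b - a) τ :=
      continuous_const.mul ((intervalIntegral.continuous_primitive
        (fun _ _ => hG.intervalIntegrable) 0).comp (continuous_id.sub continuous_const))
    simpa using (hc.tendsto a).mono_left nhdsWithin_le_nhds
  refine squeeze_zero_norm' ?_ hlim
  filter_upwards [Ioo_mem_nhdsGT hab] with t ht
  rw [kernelConv_eq_convolution_truncKernel β ht.2, convolution_def,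
    intervalIntegral.integral_of_le (by linarith [ht.1]), ← integral_const_mul,
    ← integral_indicator measurableSet_Ioc]
  refine norm_integral_le_of_norm_le ((hG.const_mul M).indicator measurableSet_Ioc)
    (Eventually.of_forall fun τ => ?_)
  simp only [ContinuousLinearMap.mul_apply', norm_mul]
  by_cases h : t - τ ∈ Icc a b
  · by_cases h0 : 0 < τ
    · rw [indicator_of_mem h, indicator_of_mem (show τ ∈ Ioc 0 (t - a) from ⟨h0, by linarith [h.1]⟩),
        Real.norm_of_nonneg (truncKernel_nonneg hβ _ _), mul_comm]
      exact mul_le_mul_of_nonneg_right (hM _ h) (truncKernel_nonneg hβ _ _)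
    · have h1 : τ ∉ Ioc 0 (t - a) := fun h' => h0 h'.1
      simp [truncKernel_of_nonpos _ _ h0, h1]
  · rw [indicator_of_notMem h]
    simp only [norm_zero, mul_zero]
    exact indicator_nonneg (fun _ _ => mul_nonneg hM0 (truncKernel_nonneg hβ _ _)) _

/-! ### Weak derivatives: larger test class, positivity, linearity. -/

/-- Multiply `φ` by cutoffs vanishing near `a`. The extra term carries the cutoff's derivative, of
size `K / e n` on an interval of length `e n` next to `a`, where `u` is small. Such test functions
arise when `φ` is shifted to the left. -/
theorem HasWeakDerivL1.integral_eq_of_tendsto_zero {a b : ℝ} (hab : a < b) {u v : ℝ → ℝ}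
    (h : HasWeakDerivL1 a b u v) (hu : Tendsto u (𝓝[>] a) (𝓝 0)) {φ : ℝ → ℝ}
    (hφ : ContDiff ℝ ∞ φ) (hc : HasCompactSupport φ) (hs : tsupport φ ⊆ Iio b) :
    ∫ t in Ioo a b, u t * deriv φ t = - ∫ t in Ioo a b, v t * φ t := by
  have hφ' : Continuous (deriv φ) := hφ.continuous_deriv (by simp)
  obtain ⟨C, hC⟩ := hc.exists_bound_of_continuous hφ.continuous
  obtain ⟨C', hC'⟩ := hc.deriv.exists_bound_of_continuous hφ'
  have hS : ContDiff ℝ ∞ Real.smoothTransition := Real.smoothTransition.contDiff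
  have hS' : Continuous (deriv Real.smoothTransition) := hS.continuous_deriv (by simp)
  have hSz : ∀ x, x ∉ Icc (0 : ℝ) 1 → deriv Real.smoothTransition x = 0 := by
    intro x hx
    rw [mem_Icc, not_and_or, not_le, not_le] at hx
    rcases hx with hx | hx
    · have : Real.smoothTransition =ᶠ[𝓝 x] fun _ => 0 := by
        filter_upwards [Iio_mem_nhds hx] with y hy
        exact Real.smoothTransition.zero_of_nonpos (le_of_lt hy)
      simp [this.deriv_eq]
    · have : Real.smoothTransition =ᶠ[𝓝 x] fun _ => 1 := by
        filter_upwards [Ioi_mem_nhds hx] with y hy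
        exact Real.smoothTransition.one_of_one_le (le_of_lt hy)
      simp [this.deriv_eq]
  obtain ⟨K, hK⟩ := isCompact_Icc.exists_bound_of_continuousOn (s := Icc (0 : ℝ) 1) hS'.continuousOn
  have hK0 : 0 ≤ K := (norm_nonneg _).trans (hK 0 (by simp))
  have hC0 : 0 ≤ C := (norm_nonneg _).trans (hC 0)
  -- the cutoff functions
  let e : ℕ → ℝ := fun n => 1 / ((n : ℝ) + 1)
  have he0 : ∀ n, 0 < e n := fun n => Nat.one_div_pos_of_nat
  have he : Tendsto e atTop (𝓝 0) := tendsto_one_div_add_atTop_nhds_zero_nat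
  -- The cutoff is `0` up to `a + e n` and `1` from `a + 2 * e n` on.
  let χ : ℕ → ℝ → ℝ := fun n t => Real.smoothTransition ((t - a) / e n - 1)
  have hχ : ∀ n, ContDiff ℝ ∞ (χ n) := fun n =>
    hS.comp (((contDiff_id.sub contDiff_const).div_const _).sub contDiff_const)
  have hχd : ∀ n t, deriv (χ n) t = deriv Real.smoothTransition ((t - a) / e n - 1) / e n := by
    intro n t
    have h1 : HasDerivAt (fun t => (t - a) / e n - 1) (1 / e n) t :=
      (((hasDerivAt_id t).sub_const a).div_const _).sub_const 1
    have h2 := ((hS.differentiable (by simp)) ((t - a) / e n - 1)).hasDerivAt.comp t h1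
    rw [show χ n = Real.smoothTransition ∘ (fun t => (t - a) / e n - 1) from rfl, h2.deriv]
    ring
  have hχ1 : ∀ n t, ‖χ n t‖ ≤ 1 := fun n t => by
    rw [Real.norm_of_nonneg (Real.smoothTransition.nonneg _)]
    exact Real.smoothTransition.le_one _
  have hχlim : ∀ t ∈ Ioo a b, Tendsto (fun n => χ n t) atTop (𝓝 1) := by
    intro t ht
    refine tendsto_const_nhds.congr' ?_
    have : ∀ᶠ n in atTop, e n < (t - a) / 2 :=
      he.eventually (gt_mem_nhds (by linarith [ht.1]))
    filter_upwards [this] with n hn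
    refine (Real.smoothTransition.one_of_one_le ?_).symm
    have : 2 ≤ (t - a) / e n := by
      rw [le_div_iff₀ (he0 n)]
      linarith
    linarith
  have hd : ∀ n t, deriv (fun t => φ t * χ n t) t
      = deriv φ t * χ n t + φ t * deriv (χ n) t := fun n t =>
    deriv_fun_mul (hφ.differentiable (by simp) t) ((hχ n).differentiable (by simp) t)
  have hsupp : ∀ n, tsupport (fun t => φ t * χ n t) ⊆ Ioo a b := by
    intro n t ht
    refine ⟨?_, hs (tsupport_mul_subset_left ht)⟩
    have h1 : t ∈ tsupport (χ n) := tsupport_mul_subset_right ht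
    have h2 : tsupport (χ n) ⊆ Ici (a + e n) := by
      refine closure_minimal (fun s hs => ?_) isClosed_Ici
      by_contra hcon
      refine hs (Real.smoothTransition.zero_of_nonpos ?_)
      have : (s - a) / e n ≤ 1 := by
        rw [div_le_one (he0 n)]
        linarith [not_le.1 (mt mem_Ici.2 hcon)]
      linarith
    have h3 := h2 h1
    have := he0 n
    simp only [mem_Ici] at h3
    linarith
  have key : ∀ n, (∫ t in Ioo a b, u t * deriv φ t * χ n t)
      + (∫ t in Ioo a b, u t * φ t * deriv (χ n) t) = - ∫ t in Ioo a b, v t * φ t * χ n t := by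
    intro n
    have h1 := h.integral_eq (fun t => φ t * χ n t) (hφ.mul (hχ n)) (hc.mul_right) (hsupp n)
    have hχ'b : ∀ t, ‖deriv (χ n) t‖ ≤ K / e n := by
      intro t
      rw [hχd, norm_div, Real.norm_of_nonneg (he0 n).le]
      refine div_le_div_of_nonneg_right ?_ (he0 n).le
      by_cases hx : (t - a) / e n - 1 ∈ Icc (0 : ℝ) 1
      · exact hK _ hx
      · rw [hSz _ hx]; simpa using hK0
    rw [← integral_add]
    · simp only [mul_assoc] at h1 ⊢
      rw [← h1]
      congr 1 with t
      rw [hd]; ring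
    · exact (h.integrableOn.mul_bdd hφ'.aestronglyMeasurable (Eventually.of_forall hC')).mul_bdd
        (hχ n).continuous.aestronglyMeasurable (Eventually.of_forall (hχ1 n))
    · exact (h.integrableOn.mul_bdd hφ.continuous.aestronglyMeasurable
        (Eventually.of_forall hC)).mul_bdd
        ((hχ n).continuous_deriv (by simp)).aestronglyMeasurable (Eventually.of_forall hχ'b)
  have lim_mul : ∀ w : ℝ → ℝ, IntegrableOn w (Ioo a b) →
      Tendsto (fun n => ∫ t in Ioo a b, w t * χ n t) atTop (𝓝 (∫ t in Ioo a b, w t)) := by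
    intro w hw
    refine tendsto_integral_of_dominated_convergence (fun t => ‖w t‖)
      (fun n => hw.aestronglyMeasurable.mul (hχ n).continuous.aestronglyMeasurable) hw.norm
      (fun n => Eventually.of_forall fun t => ?_) ?_
    · rw [norm_mul]
      exact mul_le_of_le_one_right (norm_nonneg _) (hχ1 n t)
    · filter_upwards [ae_restrict_mem measurableSet_Ioo] with t ht
      simpa using (hχlim t ht).const_mul (w t)
  have l1 := lim_mul _ (h.integrableOn.mul_bdd hφ'.aestronglyMeasurable (Eventually.of_forall hC'))
  have l2 := lim_mul _ (h.integrableOn_deriv.mul_bdd hφ.continuous.aestronglyMeasurable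
    (Eventually.of_forall hC))
  have l3 : Tendsto (fun n => ∫ t in Ioo a b, u t * φ t * deriv (χ n) t) atTop (𝓝 0) := by
    rw [Metric.tendsto_atTop']
    intro ε hε
    -- `η` will bound `|u|` near `a`. The `+ 1` in the witness covers `C * K = 0`; the factor `2` is
    -- slack.
    obtain ⟨η, hη, hηε⟩ : ∃ η > 0, 2 * (η * C * K) < ε := by
      refine ⟨ε / (4 * (C * K + 1)), by positivity, ?_⟩
      have : 0 ≤ C * K := by positivity
      have h4 : 2 * (ε / (4 * (C * K + 1)) * C * K) = ε * ((C * K) / (2 * (C * K + 1))) := by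
        field_simp; ring
      rw [h4]
      have : (C * K) / (2 * (C * K + 1)) < 1 := by
        rw [div_lt_one (by positivity)]; linarith
      nlinarith
    have hu' := (hu.eventually (Metric.ball_mem_nhds 0 hη))
    obtain ⟨δ, hδ, hδu⟩ := (mem_nhdsGT_iff_exists_Ioo_subset' hab).1 hu'
    have : ∀ᶠ n in atTop, e n < (δ - a) / 2 :=
      he.eventually (gt_mem_nhds (by have := mem_Ioi.1 hδ; linarith))
    obtain ⟨N, hN⟩ := eventually_atTop.1 this
    refine ⟨N, fun n hn => ?_⟩
    have hn := hN n hn.le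
    have hen := he0 n
    have heq : ∫ t in Ioo a b, u t * φ t * deriv (χ n) t
        = ∫ t in Ioo a b ∩ Icc (a + e n) (a + 2 * e n), u t * φ t * deriv (χ n) t := by
      refine setIntegral_eq_of_subset_of_forall_sdiff_eq_zero measurableSet_Ioo
        inter_subset_left (fun t ht => ?_)
      rw [hχd, hSz, zero_div, mul_zero]
      rintro ⟨h1, h2⟩
      refine ht.2 ⟨ht.1, ?_, ?_⟩
      · have : 1 ≤ (t - a) / e n := by linarith
        rw [le_div_iff₀ hen] at this
        linarith
      · have : (t - a) / e n ≤ 2 := by linarith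
        rw [div_le_iff₀ hen] at this
        linarith
    rw [heq, dist_zero_right]
    have hvol : volume (Ioo a b ∩ Icc (a + e n) (a + 2 * e n)) < ⊤ :=
      (measure_mono inter_subset_right).trans_lt measure_Icc_lt_top
    refine (norm_setIntegral_le_of_norm_le_const (C := η * C * (K / e n)) hvol ?_).trans_lt ?_
    · rintro t ⟨ht1, ht2⟩
      rw [norm_mul, norm_mul, hχd, norm_div, Real.norm_of_nonneg hen.le]
      have hut : ‖u t‖ ≤ η := by
        have : t ∈ Ioo a δ := ⟨ht1.1, by linarith [ht2.2]⟩
        have := hδu this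
        simpa using (le_of_lt (by simpa using this : |u t| < η))
      have hKt : ‖deriv Real.smoothTransition ((t - a) / e n - 1)‖ ≤ K := by
        by_cases hx : (t - a) / e n - 1 ∈ Icc (0 : ℝ) 1
        · exact hK _ hx
        · rw [hSz _ hx]; simpa using hK0
      gcongr
      exact hC t
    · have hv : volume.real (Ioo a b ∩ Icc (a + e n) (a + 2 * e n)) ≤ e n := by
        refine (measureReal_mono inter_subset_right measure_Icc_lt_top.ne).trans ?_
        rw [Real.volume_real_Icc_of_le (by linarith)]
        linarith
      calc η * C * (K / e n) * volume.real (Ioo a b ∩ Icc (a + e n) (a + 2 * e n))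
          ≤ η * C * (K / e n) * e n := by gcongr
        _ = η * C * K := by field_simp
        _ ≤ 2 * (η * C * K) := by
            have : 0 ≤ η * C * K := by positivity
            linarith
        _ < ε := hηε
  have l4 := l1.add l3
  rw [add_zero] at l4
  refine tendsto_nhds_unique (l4.congr key) l2.neg

/-- Test with normalized bumps shrinking to `t`: the integrals are mollifications of `w`, which
converge to `w t` at almost every `t`. -/
theorem ae_nonneg_of_forall_integral_contDiff_mul_nonneg {a b : ℝ} {w : ℝ → ℝ}
    (hw : IntegrableOn w (Ioo a b))
    (h : ∀ φ : ℝ → ℝ, ContDiff ℝ ∞ φ → HasCompactSupport φ → tsupport φ ⊆ Ioo a b → (∀ t, 0 ≤ φ t) →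
      0 ≤ ∫ t in Ioo a b, w t * φ t) :
    ∀ᵐ t ∂(volume.restrict (Ioo a b)), 0 ≤ w t := by
  let e : ℕ → ℝ := fun n => 1 / ((n : ℝ) + 1)
  have he0 : ∀ n, 0 < e n := fun n => Nat.one_div_pos_of_nat
  have he : Tendsto e atTop (𝓝 0) := tendsto_one_div_add_atTop_nhds_zero_nat
  let B : ℕ → ContDiffBump (0 : ℝ) := fun n => ⟨e n, 2 * e n, he0 n, by linarith [he0 n]⟩
  have hwi : Integrable ((Ioo a b).indicator w) := hw.integrable_indicator measurableSet_Ioo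
  have hB := ContDiffBump.ae_convolution_tendsto_right_of_locallyIntegrable (μ := volume)
    (φ := B) (l := atTop) (K := 2) (by simpa using he.const_mul 2)
    (Eventually.of_forall fun n => le_rfl) hwi.locallyIntegrable
  rw [ae_restrict_iff' measurableSet_Ioo]
  filter_upwards [hB] with t ht htm
  rw [indicator_of_mem htm] at ht
  refine ge_of_tendsto ht ?_
  have hev : ∀ᶠ n in atTop, 2 * e n < min (t - a) (b - t) := by
    have : Tendsto (fun n => 2 * e n) atTop (𝓝 0) := by simpa using he.const_mul 2
    exact this.eventually (gt_mem_nhds (by simp [htm.1, htm.2]))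
  filter_upwards [hev] with n hn
  rw [lt_min_iff] at hn
  rw [convolution_eq_swap]
  have hsub : tsupport (fun s => (B n).normed volume (t - s)) ⊆ Icc (t - 2 * e n) (t + 2 * e n) := by
    refine closure_minimal (fun s hs => ?_) isClosed_Icc
    have : t - s ∈ Function.support ((B n).normed volume) := hs
    rw [ContDiffBump.support_normed_eq, Metric.mem_ball, dist_zero_right, Real.norm_eq_abs,
      abs_lt] at this
    have h1 : -(2 * e n) < t - s := this.1
    have h2 : t - s < 2 * e n := this.2
    constructor <;> linarith
  have h1 := h (fun s => (B n).normed volume (t - s))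
    ((B n).contDiff_normed.comp (contDiff_const.sub contDiff_id))
    (HasCompactSupport.of_support_subset_isCompact isCompact_Icc ((subset_tsupport _).trans hsub))
    (hsub.trans fun s hs => ⟨by linarith [hs.1], by linarith [hs.2]⟩)
    (fun s => (B n).nonneg_normed _)
  rw [← integral_indicator measurableSet_Ioo] at h1
  refine h1.trans_eq (integral_congr_ae (Eventually.of_forall fun s => ?_))
  by_cases hs : s ∈ Ioo a b
  · simp [hs, mul_comm]
  · simp [hs]

theorem HasWeakDerivL1.sub {a b : ℝ} {u v u' v' : ℝ → ℝ}
    (h : HasWeakDerivL1 a b u v) (h' : HasWeakDerivL1 a b u' v') :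
    HasWeakDerivL1 a b (fun t => u t - u' t) (fun t => v t - v' t) where
  integrableOn := h.integrableOn.sub h'.integrableOn
  integrableOn_deriv := h.integrableOn_deriv.sub h'.integrableOn_deriv
  integral_eq φ hφ hc hs := by
    have hφ' : Continuous (deriv φ) := hφ.continuous_deriv (by simp)
    obtain ⟨C, hC⟩ := hc.exists_bound_of_continuous hφ.continuous
    obtain ⟨C', hC'⟩ := hc.deriv.exists_bound_of_continuous hφ'
    simp only [sub_mul]
    rw [integral_sub, integral_sub, h.integral_eq φ hφ hc hs, h'.integral_eq φ hφ hc hs]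
    · ring
    · exact h.integrableOn_deriv.mul_bdd hφ.continuous.aestronglyMeasurable (Eventually.of_forall hC)
    · exact h'.integrableOn_deriv.mul_bdd hφ.continuous.aestronglyMeasurable
        (Eventually.of_forall hC)
    · exact h.integrableOn.mul_bdd hφ'.aestronglyMeasurable (Eventually.of_forall hC')
    · exact h'.integrableOn.mul_bdd hφ'.aestronglyMeasurable (Eventually.of_forall hC')

theorem HasWeakDerivL1.const_mul {a b : ℝ} {u v : ℝ → ℝ} (c : ℝ) (h : HasWeakDerivL1 a b u v) :
    HasWeakDerivL1 a b (fun t => c * u t) (fun t => c * v t) where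
  integrableOn := h.integrableOn.const_mul c
  integrableOn_deriv := h.integrableOn_deriv.const_mul c
  integral_eq φ hφ hc hs := by
    simp only [mul_assoc]
    rw [integral_const_mul, integral_const_mul, h.integral_eq φ hφ hc hs]
    ring

theorem HasWeakDerivL1.congr {a b : ℝ} {u u' v : ℝ → ℝ} (h : HasWeakDerivL1 a b u v)
    (hu : ∀ t ∈ Ioo a b, u' t = u t) : HasWeakDerivL1 a b u' v where
  integrableOn := h.integrableOn.congr_fun (fun t ht => (hu t ht).symm) measurableSet_Ioo
  integrableOn_deriv := h.integrableOn_deriv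
  integral_eq φ hφ hc hs := by
    rw [← h.integral_eq φ hφ hc hs]
    exact setIntegral_congr_fun measurableSet_Ioo fun t ht => by simp only [hu t ht]

/-! ### Linearity and duality of the fractional integral; constants. -/

theorem convolution_truncKernel_exists {β a b : ℝ} (hβ : 0 < β) {f : ℝ → ℝ}
    (hf : ContinuousOn f (Icc a b)) (t : ℝ) :
    Integrable (fun τ => truncKernel β (b - a) τ * (Icc a b).indicator f (t - τ)) := by
  obtain ⟨M, hM⟩ := isCompact_Icc.exists_bound_of_continuousOn hf
  have hfi : Integrable ((Icc a b).indicator f) :=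
    (hf.integrableOn_compact isCompact_Icc).integrable_indicator measurableSet_Icc
  refine (integrable_truncKernel hβ (b - a)).mul_bdd (c := max M 0)
    (hfi.comp_sub_left t).aestronglyMeasurable (Eventually.of_forall fun τ => ?_)
  by_cases h : t - τ ∈ Icc a b
  · simpa [h] using Or.inl (hM _ h)
  · simp [h]

theorem kernelConv_sub {β a b : ℝ} (hβ : 0 < β) {f g : ℝ → ℝ}
    (hf : ContinuousOn f (Icc a b)) (hg : ContinuousOn g (Icc a b)) {t : ℝ} (ht : t < b) :
    kernelConv β a b (fun s => f s - g s) t = kernelConv β a b f t - kernelConv β a b g t := by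
  simp only [kernelConv_eq_convolution_truncKernel β ht, convolution_def,
    ContinuousLinearMap.mul_apply']
  rw [← integral_sub (convolution_truncKernel_exists hβ hf t)
    (convolution_truncKernel_exists hβ hg t)]
  congr 1 with τ
  by_cases h : t - τ ∈ Icc a b
  · simp [h, mul_sub]
  · simp [h]

theorem kernelConv_const_mul (β a b c : ℝ) (f : ℝ → ℝ) (t : ℝ) :
    kernelConv β a b (fun s => c * f s) t = c * kernelConv β a b f t := by
  simp only [kernelConv, convolution_def, ContinuousLinearMap.mul_apply']
  rw [← integral_const_mul]
  congr 1 with τ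
  by_cases h : t - τ ∈ Icc a b
  · simp [h]; ring
  · simp [h]

/-- The truncated convolution vanishes on its own left of `a` but not right of `b`, hence the
one-sided condition on `ψ`. -/
theorem integral_kernelConv_mul {β a b : ℝ} (hβ : 0 < β) {f ψ : ℝ → ℝ}
    (hf : ContinuousOn f (Icc a b)) (hψ : Continuous ψ) {C : ℝ} (hC : ∀ x, ‖ψ x‖ ≤ C)
    (hψb : ∀ t, b ≤ t → ψ t = 0) :
    ∫ t in Ioo a b, kernelConv β a b f t * ψ t
      = ∫ s, (Icc a b).indicator f s * ∫ τ, truncKernel β (b - a) τ * ψ (s + τ) := by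
  have hfi : Integrable ((Icc a b).indicator f) :=
    (hf.integrableOn_compact isCompact_Icc).integrable_indicator measurableSet_Icc
  rw [← integral_convolution_mul_eq' (integrable_truncKernel hβ (b - a)) hfi hψ hC,
    ← integral_indicator measurableSet_Ioo]
  congr 1 with t
  by_cases ht : t ∈ Ioo a b
  · rw [indicator_of_mem ht, kernelConv_eq_convolution_truncKernel β ht.2]
  · rw [indicator_of_notMem ht]
    rcases le_or_gt t a with h | h
    · rw [convolution_truncKernel_of_le β h, zero_mul]
    · rw [hψb t (not_lt.1 fun h' => ht ⟨h, h'⟩), mul_zero]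

theorem integrableOn_kernelConv {β a b : ℝ} (hβ : 0 < β) {f : ℝ → ℝ}
    (hf : ContinuousOn f (Icc a b)) : IntegrableOn (kernelConv β a b f) (Ioo a b) := by
  have hfi : Integrable ((Icc a b).indicator f) :=
    (hf.integrableOn_compact isCompact_Icc).integrable_indicator measurableSet_Icc
  have h := (integrable_truncKernel hβ (b - a)).integrable_convolution
    (ContinuousLinearMap.mul ℝ ℝ) hfi
  exact h.integrableOn.congr_fun
    (fun t ht => (kernelConv_eq_convolution_truncKernel β ht.2 f).symm) measurableSet_Ioo

/-- After Fubini the inner integral of `φ'` over the shifted interval leaves only `-c * φ (τ + a)`.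
Hence subtracting a constant from `f` preserves membership in `W^{1,1}`. -/
theorem hasWeakDerivL1_kernelConv_const {β a b : ℝ} (hβ : 0 < β) (hab : a < b) (c : ℝ) :
    HasWeakDerivL1 a b (kernelConv β a b fun _ => c)
      (fun t => c * truncKernel β (b - a) (t - a)) where
  integrableOn := integrableOn_kernelConv hβ continuousOn_const
  integrableOn_deriv :=
    (((integrable_truncKernel hβ (b - a)).comp_sub_right a).const_mul c).integrableOn
  integral_eq φ hφ hc hs := by
    have hφ' : Continuous (deriv φ) := hφ.continuous_deriv (by simp)
    obtain ⟨C, hC⟩ := hc.exists_bound_of_continuous hφ.continuous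
    obtain ⟨C', hC'⟩ := hc.deriv.exists_bound_of_continuous hφ'
    have hz : ∀ t, t ∉ Ioo a b → φ t = 0 := fun t ht =>
      image_eq_zero_of_notMem_tsupport fun h => ht (hs h)
    have hz' : ∀ t, t ∉ Ioo a b → deriv φ t = 0 := fun t ht =>
      image_eq_zero_of_notMem_tsupport fun h => ht (hs (tsupport_deriv_subset h))
    have hfi : Integrable ((Icc a b).indicator fun _ : ℝ => c) :=
      ((continuousOn_const (c := c)).integrableOn_compact isCompact_Icc).integrable_indicator
        measurableSet_Icc
    rw [integral_kernelConv_mul hβ continuousOn_const hφ' hC'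
      (fun t ht => hz' t fun h => by linarith [h.2]),
      ← integral_convolution_mul_eq' (integrable_truncKernel hβ (b - a)) hfi hφ' hC',
      integral_convolution_mul_eq (integrable_truncKernel hβ (b - a)) hfi hφ' hC',
      setIntegral_eq_integral_of_forall_compl_eq_zero (fun t ht => by rw [hz t ht, mul_zero]),
      ← integral_add_right_eq_self (fun t => c * truncKernel β (b - a) (t - a) * φ t) a,
      ← integral_neg]
    congr 1 with τ
    by_cases hτ : 0 < τ
    · have h1 : ∫ s, (Icc a b).indicator (fun _ => c) s * deriv φ (τ + s)
          = c * ∫ s in a..b, deriv φ (τ + s) := by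
        rw [intervalIntegral.integral_of_le hab.le, ← integral_Icc_eq_integral_Ioc,
          ← integral_const_mul, ← integral_indicator measurableSet_Icc]
        congr 1 with s
        by_cases h : s ∈ Icc a b <;> simp [h]
      have h2 : ∫ s in a..b, deriv φ (τ + s) = φ (τ + b) - φ (τ + a) := by
        rw [intervalIntegral.integral_comp_add_left (fun s => deriv φ s) τ]
        exact intervalIntegral.integral_deriv_eq_sub
          (fun x _ => hφ.differentiable (by simp) x) (hφ'.intervalIntegrable _ _)
      rw [h1, h2, hz (τ + b) (fun h => by linarith [h.2])]
      simp; ring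
    · simp [truncKernel_of_nonpos _ _ hτ]

/-! ### The regularized kernel. -/

/-- The convolution of `g_{1-α}` with the gamma density of shape `α` and rate `n`: a mixture of
decaying exponentials. -/
noncomputable def regularKernel (α n ρ : ℝ) : ℝ :=
  n ^ α * ProbabilityTheory.mgf id (ProbabilityTheory.betaMeasure α (1 - α)) (-(n * ρ))

section RegularKernel

open ProbabilityTheory

variable {α : ℝ}

theorem ae_betaMeasure_mem_Icc (a b : ℝ) : ∀ᵐ x ∂(betaMeasure a b), x ∈ Icc (0 : ℝ) 1 := by
  rw [betaMeasure, ae_withDensity_iff (by unfold betaPDF; fun_prop)]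
  refine Eventually.of_forall fun x hx => ⟨?_, ?_⟩
  · by_contra h
    exact hx (betaPDF_eq_zero_of_nonpos (not_le.1 h).le)
  · by_contra h
    exact hx (betaPDF_eq_zero_of_one_le (not_le.1 h).le)

theorem interior_integrableExpSet_betaMeasure {a b : ℝ} (ha : 0 < a) (hb : 0 < b) :
    interior (integrableExpSet id (betaMeasure a b)) = univ := by
  have := isProbabilityMeasureBeta ha hb
  rw [interior_eq_univ]
  refine eq_univ_of_forall fun t => ?_
  exact integrable_exp_mul_of_mem_Icc aemeasurable_id (ae_betaMeasure_mem_Icc a b)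

/-- The beta law lives on `[0, 1]`, so its moment generating function is analytic on all of `ℝ`, and
the kernel is smooth through `0`. -/
theorem contDiff_regularKernel (hα : α ∈ Ioo (0 : ℝ) 1) (n : ℝ) :
    ContDiff ℝ 1 (regularKernel α n) := by
  have h : AnalyticOnNhd ℝ (mgf id (betaMeasure α (1 - α))) univ := by
    rw [← interior_integrableExpSet_betaMeasure hα.1 (sub_pos.2 hα.2)]
    exact analyticOnNhd_mgf
  exact contDiff_const.mul (h.contDiff.comp (contDiff_const.mul contDiff_id).neg)

theorem regularKernel_nonneg {n : ℝ} (hn : 0 < n) (ρ : ℝ) : 0 ≤ regularKernel α n ρ :=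
  mul_nonneg (Real.rpow_nonneg hn.le _) mgf_nonneg

theorem deriv_regularKernel_nonpos (hα : α ∈ Ioo (0 : ℝ) 1) {n : ℝ} (hn : 0 < n) (ρ : ℝ) :
    deriv (regularKernel α n) ρ ≤ 0 := by
  have hmem : -(n * ρ) ∈ interior (integrableExpSet id (betaMeasure α (1 - α))) := by
    rw [interior_integrableExpSet_betaMeasure hα.1 (sub_pos.2 hα.2)]
    trivial
  have h1 : HasDerivAt (fun ρ : ℝ => -(n * ρ)) (-n) ρ := by
    simpa using ((hasDerivAt_id ρ).const_mul n).fun_neg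
  have h2 := ((hasDerivAt_mgf hmem).comp ρ h1).const_mul (n ^ α)
  have h3 : deriv (regularKernel α n) ρ = _ := h2.deriv
  rw [h3]
  have h4 : 0 ≤ ∫ x, id x * Real.exp (-(n * ρ) * id x) ∂(betaMeasure α (1 - α)) := by
    refine integral_nonneg_of_ae ?_
    filter_upwards [ae_betaMeasure_mem_Icc α (1 - α)] with x hx
    exact mul_nonneg hx.1 (Real.exp_pos _).le
  have h5 : 0 ≤ n ^ α := Real.rpow_nonneg hn.le _
  nlinarith [mul_nonneg h5 (mul_nonneg h4 hn.le)]

/-- Substituting `r = ρ x` turns the integrand into the beta density times `exp (-nρx)`. The powers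
of `ρ` cancel exactly because the shapes `α` and `1 - α` add up to `1`. -/
theorem convolution_gammaPDFReal_truncKernel (hα : α ∈ Ioo (0 : ℝ) 1) {n R ρ : ℝ}
    (hρ : ρ ∈ Ioo 0 R) :
    ∫ r, gammaPDFReal α n r * truncKernel (1 - α) R (ρ - r) = regularKernel α n ρ := by
  have hsub := Measure.integral_comp_mul_left
    (fun r => gammaPDFReal α n r * truncKernel (1 - α) R (ρ - r)) ρ
  have hα1 : (0 : ℝ) < 1 - α := sub_pos.2 hα.2
  have hβ : beta α (1 - α) = Real.Gamma α * Real.Gamma (1 - α) := by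
    simp [beta]
  have h1 : ∀ x, ρ * (gammaPDFReal α n (ρ * x) * truncKernel (1 - α) R (ρ - ρ * x))
      = n ^ α * (betaPDFReal α (1 - α) x * Real.exp (-(n * ρ) * x)) := by
    intro x
    by_cases hx : 0 < x ∧ x < 1
    · have hρx : 0 < ρ * x := mul_pos hρ.1 hx.1
      have hρx' : ρ * x < ρ := by nlinarith [hρ.1]
      rw [gammaPDFReal, if_pos hρx.le, truncKernel_of_mem _ ⟨by linarith, by linarith [hρ.2]⟩,
        betaPDFReal, if_pos hx, hβ, Real.mul_rpow hρ.1.le hx.1.le,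
        show ρ - ρ * x = ρ * (1 - x) by ring, Real.mul_rpow hρ.1.le (by linarith [hx.2])]
      have hpow : ρ * (ρ ^ (α - 1) * ρ ^ (1 - α - 1)) = 1 := by
        rw [← Real.rpow_add hρ.1]
        nth_rewrite 1 [← Real.rpow_one ρ]
        rw [← Real.rpow_add hρ.1]
        ring_nf
        simp
      rw [show -(n * ρ) * x = -(n * (ρ * x)) by ring]
      calc _ = (ρ * (ρ ^ (α - 1) * ρ ^ (1 - α - 1))) * (n ^ α * (1 / (Real.Gamma α
              * Real.Gamma (1 - α)) * x ^ (α - 1) * (1 - x) ^ (1 - α - 1)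
              * Real.exp (-(n * (ρ * x))))) := by ring
        _ = _ := by rw [hpow, one_mul]
    · rw [betaPDFReal, if_neg hx]
      rw [not_and_or, not_lt, not_lt] at hx
      rcases hx with hx | hx
      · rcases hx.lt_or_eq with hx | rfl
        · rw [gammaPDFReal, if_neg (by nlinarith [hρ.1])]
          simp
        -- At `x = 0` both sides are `0`, by the convention that `0` to a nonzero real power is `0`.
        · have : α - 1 ≠ 0 := by linarith
          simp [gammaPDFReal, Real.zero_rpow this]
      · rw [truncKernel_of_nonpos _ _ (by nlinarith [hρ.1])]
        simp
  rw [regularKernel, mgf, betaMeasure, integral_withDensity_eq_integral_toReal_smul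
    (f := betaPDF α (1 - α)) (by unfold betaPDF; fun_prop)
    (Eventually.of_forall fun x => ENNReal.ofReal_lt_top),
    ← integral_const_mul]
  have h2 : ∀ x, n ^ α * ((betaPDF α (1 - α) x).toReal • Real.exp (-(n * ρ) * id x))
      = ρ * (gammaPDFReal α n (ρ * x) * truncKernel (1 - α) R (ρ - ρ * x)) := by
    intro x
    rw [h1, betaPDF, ENNReal.toReal_ofReal, smul_eq_mul, id]
    by_cases hx : 0 < x ∧ x < 1
    · exact (betaPDFReal_pos hx.1 hx.2 hα.1 hα1).le
    · rw [betaPDFReal, if_neg hx]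
  simp_rw [h2]
  rw [integral_const_mul, hsub, abs_of_pos (inv_pos.2 hρ.1), smul_eq_mul, ← mul_assoc,
    mul_inv_cancel₀ hρ.1.ne', one_mul]

theorem convolution_gammaPDFReal_truncKernel_of_nonpos {n R ρ : ℝ} (hρ : ρ ≤ 0) :
    ∫ r, gammaPDFReal α n r * truncKernel (1 - α) R (ρ - r) = 0 := by
  refine integral_eq_zero_of_ae (Eventually.of_forall fun r => ?_)
  by_cases hr : 0 ≤ r
  · simp [truncKernel_of_nonpos (1 - α) R (t := ρ - r) (by linarith)]
  · simp [gammaPDFReal, hr]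

/-! ### Gamma densities as an approximate identity. -/

theorem integrable_gammaPDFReal {n : ℝ} (hα : 0 < α) (hn : 0 < n) :
    Integrable (gammaPDFReal α n) := by
  refine ⟨(measurable_gammaPDFReal α n).aestronglyMeasurable, ?_⟩
  rw [hasFiniteIntegral_iff_ofReal (Eventually.of_forall (gammaPDFReal_nonneg hα hn))]
  have := lintegral_gammaPDF_eq_one hα hn
  unfold gammaPDF at this
  simp [this]

theorem integral_gammaPDFReal {n : ℝ} (hα : 0 < α) (hn : 0 < n) :
    ∫ r, gammaPDFReal α n r = 1 := by
  rw [integral_eq_lintegral_of_nonneg_ae (Eventually.of_forall (gammaPDFReal_nonneg hα hn))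
    (measurable_gammaPDFReal α n).aestronglyMeasurable]
  have := lintegral_gammaPDF_eq_one hα hn
  unfold gammaPDF at this
  simp [this]

/-- The rate is a scaling parameter, `γ_n(r) = n γ_1(n r)`; after rescaling, dominated convergence
applies. -/
theorem tendsto_integral_gammaPDFReal_mul (hα : 0 < α) {Θ : ℝ → ℝ} (hΘ : Continuous Θ) {C : ℝ}
    (hC : ∀ x, ‖Θ x‖ ≤ C) :
    Tendsto (fun n : ℝ => ∫ r, gammaPDFReal α n r * Θ r) atTop (𝓝 (Θ 0)) := by
  have h1 : Tendsto (fun n : ℝ => ∫ x, gammaPDFReal α 1 x * Θ (n⁻¹ * x)) atTop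
      (𝓝 (∫ x, gammaPDFReal α 1 x * Θ 0)) := by
    have hi := integrable_gammaPDFReal hα one_pos
    refine tendsto_integral_filter_of_dominated_convergence
      (fun x => ‖gammaPDFReal α 1 x‖ * C) (Eventually.of_forall fun n => ?_)
      (Eventually.of_forall fun n => Eventually.of_forall fun x => ?_) (hi.norm.mul_const C)
      (Eventually.of_forall fun x => ?_)
    · exact hi.aestronglyMeasurable.mul
        (hΘ.comp (continuous_const.mul continuous_id)).aestronglyMeasurable
    · rw [norm_mul]
      exact mul_le_mul_of_nonneg_left (hC _) (norm_nonneg _)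
    · refine ((hΘ.tendsto 0).comp ?_).const_mul _
      simpa using tendsto_inv_atTop_zero.mul_const x
  rw [integral_mul_const, integral_gammaPDFReal hα one_pos, one_mul] at h1
  refine h1.congr' ?_
  filter_upwards [eventually_gt_atTop 0] with n hn
  have hsub := Measure.integral_comp_mul_left (fun r => gammaPDFReal α n r * Θ r) n⁻¹
  rw [inv_inv, abs_of_pos hn, smul_eq_mul] at hsub
  have h2 : ∀ x, gammaPDFReal α n (n⁻¹ * x) * Θ (n⁻¹ * x)
      = n * (gammaPDFReal α 1 x * Θ (n⁻¹ * x)) := by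
    intro x
    rw [← mul_assoc]
    congr 1
    by_cases hx : 0 ≤ x
    · rw [gammaPDFReal, gammaPDFReal, if_pos hx, if_pos (by positivity),
        Real.mul_rpow (by positivity) hx, Real.inv_rpow hn.le, Real.one_rpow,
        Real.rpow_sub_one hn.ne', one_mul, mul_inv_cancel_left₀ hn.ne']
      have : n ^ α ≠ 0 := (Real.rpow_pos_of_pos hn _).ne'
      field_simp
    · have : ¬ 0 ≤ n⁻¹ * x := by
        have := mul_pos (inv_pos.2 hn) (neg_pos.2 (not_le.1 hx))
        nlinarith
      simp [gammaPDFReal, hx, this]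
  simp_rw [h2, integral_const_mul] at hsub
  exact mul_left_cancel₀ hn.ne' hsub

end RegularKernel

/-! ### The weak derivative convolved with the gamma density. -/

theorem norm_integral_mul_comp_add_le {A ψ : ℝ → ℝ} (hA : Integrable A) {C : ℝ}
    (hC : ∀ x, ‖ψ x‖ ≤ C) (x : ℝ) : ‖∫ τ, A τ * ψ (x + τ)‖ ≤ ∫ τ, ‖A τ‖ * C := by
  refine norm_integral_le_of_norm_le (hA.norm.mul_const C) (Eventually.of_forall fun τ => ?_)
  rw [norm_mul]
  exact mul_le_mul_of_nonneg_left (hC _) (norm_nonneg _)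

theorem continuous_integral_mul_comp_add {A ψ : ℝ → ℝ} (hA : Integrable A) (hψ : Continuous ψ)
    {C : ℝ} (hC : ∀ x, ‖ψ x‖ ≤ C) : Continuous fun x => ∫ τ, A τ * ψ (x + τ) := by
  refine continuous_of_dominated (bound := fun τ => ‖A τ‖ * C) (fun x => ?_)
    (fun x => Eventually.of_forall fun τ => ?_) (hA.norm.mul_const C)
    (Eventually.of_forall fun τ => ?_)
  · exact hA.aestronglyMeasurable.mul
      (hψ.comp (continuous_const.add continuous_id)).aestronglyMeasurable
  · rw [norm_mul]
    exact mul_le_mul_of_nonneg_left (hC _) (norm_nonneg _)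
  · exact continuous_const.mul (hψ.comp (continuous_id.add continuous_const))

/-- The negative derivative of `regularKernel` on `(0, R]`, extended by zero. -/
noncomputable def regularKernelDecay (α n R : ℝ) : ℝ → ℝ :=
  (Ioc 0 R).indicator fun ρ => -deriv (regularKernel α n) ρ

section

open ProbabilityTheory

variable {α : ℝ}

theorem continuous_deriv_regularKernel (hα : α ∈ Ioo (0 : ℝ) 1) (n : ℝ) :
    Continuous (deriv (regularKernel α n)) :=
  (contDiff_regularKernel hα n).continuous_deriv le_rfl

theorem integrable_regularKernelDecay (hα : α ∈ Ioo (0 : ℝ) 1) (n R : ℝ) :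
    Integrable (regularKernelDecay α n R) :=
  ((((continuous_deriv_regularKernel hα n).neg.continuousOn).integrableOn_compact
    (isCompact_Icc (a := 0) (b := R))).mono_set Ioc_subset_Icc_self).integrable_indicator
    measurableSet_Ioc

theorem regularKernelDecay_nonneg (hα : α ∈ Ioo (0 : ℝ) 1) {n : ℝ} (hn : 0 < n) (R ρ : ℝ) :
    0 ≤ regularKernelDecay α n R ρ :=
  indicator_nonneg (fun _ _ => neg_nonneg.2 (deriv_regularKernel_nonpos hα hn _)) _

theorem integral_regularKernelDecay_le (hα : α ∈ Ioo (0 : ℝ) 1) {n R : ℝ} (hn : 0 < n)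
    (hR : 0 ≤ R) : ∫ ρ, regularKernelDecay α n R ρ ≤ regularKernel α n 0 := by
  unfold regularKernelDecay
  rw [integral_indicator measurableSet_Ioc, ← intervalIntegral.integral_of_le hR,
    intervalIntegral.integral_neg, intervalIntegral.integral_deriv_eq_sub
      (fun x _ => (contDiff_regularKernel hα n).differentiable (by simp) x)
      ((continuous_deriv_regularKernel hα n).intervalIntegrable _ _)]
  linarith [regularKernel_nonneg (α := α) hn R]

theorem integral_regularKernel_mul_deriv (hα : α ∈ Ioo (0 : ℝ) 1) (n : ℝ) {R s : ℝ}
    (hR : 0 ≤ R) {φ : ℝ → ℝ} (hφ : ContDiff ℝ ∞ φ) (hz : φ (s + R) = 0) :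
    ∫ ρ in (0 : ℝ)..R, regularKernel α n ρ * deriv φ (s + ρ)
      = -(regularKernel α n 0 * φ s) + ∫ ρ, regularKernelDecay α n R ρ * φ (s + ρ) := by
  have hφ' : Continuous (deriv φ) := hφ.continuous_deriv (by simp)
  have hk' := continuous_deriv_regularKernel hα n
  rw [intervalIntegral.integral_mul_deriv_eq_deriv_mul (u' := deriv (regularKernel α n))
    (v := fun ρ => φ (s + ρ))
    (fun x _ => ((contDiff_regularKernel hα n).differentiable (by simp) x).hasDerivAt)
    (fun x _ => (hφ.differentiable (by simp) (s + x)).hasDerivAt.comp_const_add s x)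
    (hk'.intervalIntegrable _ _)
    ((hφ'.comp (continuous_const.add continuous_id)).intervalIntegrable _ _),
    hz, intervalIntegral.integral_of_le hR, ← integral_indicator measurableSet_Ioc,
    sub_eq_add_neg, ← integral_neg]
  congr 1
  · simp
  · congr 1 with ρ
    by_cases h : ρ ∈ Ioc 0 R <;> simp [regularKernelDecay, h]

/-- Associativity of convolution in dual form, then integration by parts. Truncation makes `γ_n *
g_{1-α}` equal to the regularized kernel only on `(0, R)`; beyond `R` the factor `φ'` vanishes. -/
theorem integral_gammaPDFReal_mul_truncKernel_mul (hα : α ∈ Ioo (0 : ℝ) 1) {n R s : ℝ} (hn : 0 < n)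
    (hR : 0 ≤ R) {φ : ℝ → ℝ} (hφ : ContDiff ℝ ∞ φ) (hc : HasCompactSupport φ)
    (hz : ∀ t, s + R ≤ t → φ t = 0) (hz' : ∀ t, s + R ≤ t → deriv φ t = 0) :
    ∫ r, gammaPDFReal α n r * ∫ τ, truncKernel (1 - α) R τ * deriv φ (s + r + τ)
      = -(regularKernel α n 0 * φ s) + ∫ ρ, regularKernelDecay α n R ρ * φ (s + ρ) := by
  have hφ' : Continuous (deriv φ) := hφ.continuous_deriv (by simp)
  obtain ⟨C', hC'⟩ := hc.deriv.exists_bound_of_continuous hφ'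
  have h := integral_convolution_mul_eq (integrable_gammaPDFReal hα.1 hn)
    (integrable_truncKernel (sub_pos.2 hα.2) R)
    (ψ := fun x => deriv φ (s + x)) (hφ'.comp (continuous_const.add continuous_id))
    (fun x => hC' (s + x))
  simp only [← add_assoc] at h
  rw [← h, ← integral_regularKernel_mul_deriv hα n hR hφ (hz _ le_rfl),
    intervalIntegral.integral_of_le hR, integral_Ioc_eq_integral_Ioo,
    ← integral_indicator measurableSet_Ioo]
  congr 1 with ρ
  rw [convolution_def]
  simp only [ContinuousLinearMap.mul_apply']
  by_cases hρ : ρ ∈ Ioo 0 R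
  · rw [indicator_of_mem hρ, convolution_gammaPDFReal_truncKernel hα hρ]
  · rw [indicator_of_notMem hρ]
    rcases le_or_gt ρ 0 with h0 | h0
    · rw [convolution_gammaPDFReal_truncKernel_of_nonpos h0, zero_mul]
    · rw [hz' _ (by linarith [not_lt.1 fun h' => hρ ⟨h0, h'⟩]), mul_zero]

/-- Formally `γ_n * (g_{1-α} * u)' = (k_n * u)'`. Both sides are tested against `φ`, all
convolutions being moved onto `φ`. -/
theorem convolution_gammaPDFReal_weakDeriv_ae_eq (hα : α ∈ Ioo (0 : ℝ) 1) {a b : ℝ} (hab : a < b)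
    {u v : ℝ → ℝ} (hu : ContinuousOn u (Icc a b))
    (h : HasWeakDerivL1 a b (kernelConv (1 - α) a b u) v) {n : ℝ} (hn : 0 < n) :
    ∀ᵐ t, t ∈ Ioo a b →
      (gammaPDFReal α n ⋆[ContinuousLinearMap.mul ℝ ℝ, volume] (Ioo a b).indicator v) t
        = regularKernel α n 0 * u t - ∫ ρ, regularKernelDecay α n (b - a) ρ *
            (Icc a b).indicator u (t - ρ) := by
  have hα1 : 0 < 1 - α := sub_pos.2 hα.2
  have hR : 0 ≤ b - a := by linarith
  have hui : Integrable ((Icc a b).indicator u) :=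
    (hu.integrableOn_compact isCompact_Icc).integrable_indicator measurableSet_Icc
  have hvi : Integrable ((Ioo a b).indicator v) :=
    h.integrableOn_deriv.integrable_indicator measurableSet_Ioo
  have hg := integrable_gammaPDFReal hα.1 hn
  have hQ := integrable_regularKernelDecay hα n (b - a)
  have hG := integrable_truncKernel hα1 (b - a)
  obtain ⟨M, hM⟩ := isCompact_Icc.exists_bound_of_continuousOn hu
  have hV := hg.integrable_convolution (ContinuousLinearMap.mul ℝ ℝ) hvi
  have hQu := hQ.integrable_convolution (ContinuousLinearMap.mul ℝ ℝ) hui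
  have hint := hV.sub ((hui.const_mul (regularKernel α n 0)).sub hQu)
  have key := isOpen_Ioo.ae_eq_zero_of_integral_contDiff_smul_eq_zero (U := Ioo a b)
    (μ := volume) (hint.locallyIntegrable.locallyIntegrableOn _) ?_
  · filter_upwards [key] with t ht htm
    have := sub_eq_zero.1 (ht htm)
    rw [this]
    simp only [Pi.sub_apply, indicator_of_mem (Ioo_subset_Icc_self htm), convolution_def,
      ContinuousLinearMap.mul_apply']
  intro φ hφ hc hs
  have hφ' : Continuous (deriv φ) := hφ.continuous_deriv (by simp)
  obtain ⟨C, hC⟩ := hc.exists_bound_of_continuous hφ.continuous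
  obtain ⟨C', hC'⟩ := hc.deriv.exists_bound_of_continuous hφ'
  have hz : ∀ t, b ≤ t → φ t = 0 := fun t ht =>
    image_eq_zero_of_notMem_tsupport fun h => (hs h).2.not_ge ht
  have hz' : ∀ t, b ≤ t → deriv φ t = 0 := fun t ht =>
    image_eq_zero_of_notMem_tsupport fun h => (hs (tsupport_deriv_subset h)).2.not_ge ht
  let Ψ : ℝ → ℝ := fun x => ∫ τ, truncKernel (1 - α) (b - a) τ * deriv φ (x + τ)
  have hΨ : Continuous Ψ := continuous_integral_mul_comp_add hG hφ' hC'
  have hΨC := norm_integral_mul_comp_add_le hG hC'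
  -- The shift by `r ≥ 0` moves the support of `φ` left, possibly across `a` but never up to `b`;
  -- this is where the vanishing limit at `a` enters. Negative `r` carries no gamma mass.
  have hshift : ∀ r, 0 ≤ r → ∫ s, (Ioo a b).indicator v s * φ (r + s)
      = -∫ s, (Icc a b).indicator u s * Ψ (r + s) := by
    intro r hr
    have hsφ : ContDiff ℝ ∞ fun s => φ (r + s) := hφ.comp (contDiff_const.add contDiff_id)
    have hcφ : HasCompactSupport fun s => φ (r + s) :=
      hc.comp_homeomorph (Homeomorph.addLeft r)
    have hdφ : deriv (fun s => φ (r + s)) = fun s => deriv φ (r + s) :=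
      funext fun s => deriv_comp_const_add _ _ _
    have hsub : tsupport (fun s => φ (r + s)) ⊆ Iio b := by
      intro s hs'
      have h1 : r + s ∈ tsupport φ :=
        tsupport_comp_subset_preimage φ (continuous_const.add continuous_id) hs'
      have := (hs h1).2
      simp only [mem_Iio]
      linarith
    have h1 := h.integral_eq_of_tendsto_zero hab (tendsto_kernelConv_nhdsGT hα1 hab hM)
      hsφ hcφ hsub
    rw [hdφ, integral_kernelConv_mul (ψ := fun s => deriv φ (r + s)) hα1 hu
      (hφ'.comp (continuous_const.add continuous_id))
      (fun x => hC' _) (fun t ht => hz' _ (by linarith))] at h1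
    simp only [← add_assoc] at h1
    have h2 : ∫ s, (Ioo a b).indicator v s * φ (r + s) = ∫ s in Ioo a b, v s * φ (r + s) := by
      rw [← integral_indicator measurableSet_Ioo]
      congr 1 with s
      by_cases hs' : s ∈ Ioo a b <;> simp [hs']
    rw [h2, ← neg_eq_iff_eq_neg.2 h1]
  have hVφ : ∫ t, (gammaPDFReal α n ⋆[ContinuousLinearMap.mul ℝ ℝ, volume]
      (Ioo a b).indicator v) t * φ t
      = ∫ s, (Icc a b).indicator u s * (regularKernel α n 0 * φ s
          - ∫ ρ, regularKernelDecay α n (b - a) ρ * φ (s + ρ)) := by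
    rw [integral_convolution_mul_eq hg hvi hφ.continuous hC]
    have h1 : ∀ r, gammaPDFReal α n r * ∫ s, (Ioo a b).indicator v s * φ (r + s)
        = -(gammaPDFReal α n r * ∫ s, (Icc a b).indicator u s * Ψ (r + s)) := by
      intro r
      by_cases hr : 0 ≤ r
      · rw [hshift r hr]; ring
      · simp [gammaPDFReal, hr]
    simp_rw [h1]
    rw [integral_neg, ← integral_convolution_mul_eq hg hui hΨ hΨC,
      integral_convolution_mul_eq' hg hui hΨ hΨC, ← integral_neg]
    congr 1 with s
    by_cases hs' : s ∈ Icc a b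
    · rw [integral_gammaPDFReal_mul_truncKernel_mul hα hn hR hφ hc
        (fun t ht => hz t (by linarith [hs'.1])) (fun t ht => hz' t (by linarith [hs'.1]))]
      ring
    · simp [hs']
  have hbd : ∀ {w : ℝ → ℝ}, Integrable w → Integrable fun t => w t * φ t := fun hw =>
    hw.mul_bdd hφ.continuous.aestronglyMeasurable (Eventually.of_forall hC)
  have hpφ : ∫ t, (regularKernel α n 0 * (Icc a b).indicator u t
      - (regularKernelDecay α n (b - a) ⋆[ContinuousLinearMap.mul ℝ ℝ, volume]
        (Icc a b).indicator u) t) * φ t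
      = ∫ s, (Icc a b).indicator u s * (regularKernel α n 0 * φ s
          - ∫ ρ, regularKernelDecay α n (b - a) ρ * φ (s + ρ)) := by
    simp only [sub_mul, mul_sub]
    rw [integral_sub (hbd (hui.const_mul _)) (hbd hQu),
      integral_convolution_mul_eq' hQ hui hφ.continuous hC, integral_sub]
    · congr 2 with t
      ring
    · exact (hbd (hui.const_mul (regularKernel α n 0))).congr
        (Eventually.of_forall fun t => by ring)
    · exact hui.mul_bdd
        (continuous_integral_mul_comp_add hQ hφ.continuous hC).aestronglyMeasurable
        (Eventually.of_forall (norm_integral_mul_comp_add_le hQ hC))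
  refine Eq.trans (integral_congr_ae (Eventually.of_forall fun t => ?_))
    ((integral_sub (hbd hV) (hbd ((hui.const_mul (regularKernel α n 0)).sub hQu))).trans
      (sub_eq_zero.2 (hVφ.trans hpφ.symm)))
  simp only [Pi.sub_apply, smul_eq_mul]
  ring

/-- Integrate `q(ρ) (u(t) - u(t - ρ))² ≥ 0`, or `q(ρ) u(t)² ≥ 0` where `t - ρ` leaves the interval,
and use `∫ q ≤ k_n(0)`. -/
theorem regularized_sq_le (hα : α ∈ Ioo (0 : ℝ) 1) {a b : ℝ} (hab : a < b)
    {u : ℝ → ℝ} (hu : ContinuousOn u (Icc a b)) {n : ℝ} (hn : 0 < n) (t : ℝ) :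
    regularKernel α n 0 * u t ^ 2 - ∫ ρ, regularKernelDecay α n (b - a) ρ *
        (Icc a b).indicator (fun s => u s ^ 2) (t - ρ)
      ≤ 2 * u t * (regularKernel α n 0 * u t - ∫ ρ, regularKernelDecay α n (b - a) ρ *
        (Icc a b).indicator u (t - ρ)) := by
  have hQ := integrable_regularKernelDecay hα n (b - a)
  have hi : ∀ w : ℝ → ℝ, ContinuousOn w (Icc a b) →
      Integrable fun ρ => regularKernelDecay α n (b - a) ρ * (Icc a b).indicator w (t - ρ) := by
    intro w hw
    obtain ⟨M, hM⟩ := isCompact_Icc.exists_bound_of_continuousOn hw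
    have hwi : Integrable ((Icc a b).indicator w) :=
      (hw.integrableOn_compact isCompact_Icc).integrable_indicator measurableSet_Icc
    refine hQ.mul_bdd (c := max M 0) (hwi.comp_sub_left t).aestronglyMeasurable
      (Eventually.of_forall fun τ => ?_)
    by_cases h : t - τ ∈ Icc a b
    · simpa [h] using Or.inl (hM _ h)
    · simp [h]
  have hu2 : ContinuousOn (fun s => u s ^ 2) (Icc a b) := hu.pow 2
  have h1 : 2 * u t * (∫ ρ, regularKernelDecay α n (b - a) ρ * (Icc a b).indicator u (t - ρ))
      - ∫ ρ, regularKernelDecay α n (b - a) ρ * (Icc a b).indicator (fun s => u s ^ 2) (t - ρ)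
      ≤ (∫ ρ, regularKernelDecay α n (b - a) ρ) * u t ^ 2 := by
    rw [← integral_const_mul, ← integral_mul_const,
      ← integral_sub ((hi u hu).const_mul _) (hi _ hu2)]
    refine integral_mono (((hi u hu).const_mul _).sub (hi _ hu2)) (hQ.mul_const _)
      fun ρ => ?_
    have hq := regularKernelDecay_nonneg hα hn (b - a) ρ
    by_cases h : t - ρ ∈ Icc a b
    · simp only [indicator_of_mem h]
      nlinarith [mul_nonneg hq (sq_nonneg (u t - u (t - ρ)))]
    · simp only [indicator_of_notMem h]
      nlinarith [mul_nonneg hq (sq_nonneg (u t))]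
  have h2 := integral_regularKernelDecay_le hα hn (R := b - a) (by linarith)
  nlinarith [mul_le_mul_of_nonneg_right h2 (sq_nonneg (u t))]

theorem tendsto_integral_convolution_gammaPDFReal_mul (hα : 0 < α) {v ψ : ℝ → ℝ}
    (hv : Integrable v) (hψ : Continuous ψ) {C : ℝ} (hC : ∀ x, ‖ψ x‖ ≤ C) :
    Tendsto (fun n => ∫ t, (gammaPDFReal α n ⋆[ContinuousLinearMap.mul ℝ ℝ, volume] v) t * ψ t)
      atTop (𝓝 (∫ t, v t * ψ t)) := by
  have h := tendsto_integral_gammaPDFReal_mul hα (continuous_integral_mul_comp_add hv hψ hC)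
    (norm_integral_mul_comp_add_le hv hC)
  simp only [zero_add] at h
  refine h.congr' ?_
  filter_upwards [eventually_gt_atTop 0] with n hn
  exact (integral_convolution_mul_eq (integrable_gammaPDFReal hα hn) hv hψ hC).symm

end

/-! ### Passage to the limit and reduction to `f - f(t₀)`. -/

theorem weakDeriv_kernelConv_sq_le {α : ℝ} (hα : α ∈ Ioo (0 : ℝ) 1) {a b : ℝ} (hab : a < b)
    {u v w : ℝ → ℝ} (hu : ContinuousOn u (Icc a b))
    (hv : HasWeakDerivL1 a b (kernelConv (1 - α) a b u) v)
    (hw : HasWeakDerivL1 a b (kernelConv (1 - α) a b fun t => u t ^ 2) w) :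
    ∀ᵐ t ∂(volume.restrict (Ioo a b)), w t ≤ 2 * v t * u t := by
  -- A bounded continuous extension of `u`, so that `2 * U * φ` is an admissible, merely continuous
  -- test function on the line.
  let U : ℝ → ℝ := IccExtend hab.le ((Icc a b).domRestrict u)
  have hU : Continuous U := hu.domRestrict.Icc_extend'
  have hUu : ∀ t ∈ Icc a b, U t = u t := fun t ht => IccExtend_of_mem _ _ ht
  obtain ⟨M, hM⟩ := isCompact_Icc.exists_bound_of_continuousOn hu
  have hUM : ∀ t, ‖U t‖ ≤ M := fun t => hM _ (projIcc a b hab.le t).2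
  have hvi : Integrable ((Ioo a b).indicator v) :=
    hv.integrableOn_deriv.integrable_indicator measurableSet_Ioo
  have hwi : Integrable ((Ioo a b).indicator w) :=
    hw.integrableOn_deriv.integrable_indicator measurableSet_Ioo
  have hint : IntegrableOn (fun t => v t * (2 * U t) - w t) (Ioo a b) :=
    (hv.integrableOn_deriv.mul_bdd (g := fun t => 2 * U t) (c := 2 * M)
      (continuous_const.mul hU).aestronglyMeasurable (Eventually.of_forall fun t => by
        rw [norm_mul]; simpa using hUM t)).sub hw.integrableOn_deriv
  have hu2 : ContinuousOn (fun t => u t ^ 2) (Icc a b) := hu.pow 2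
  have key := ae_nonneg_of_forall_integral_contDiff_mul_nonneg hint ?_
  · filter_upwards [key, ae_restrict_mem measurableSet_Ioo] with t ht htm
    rw [hUu t (Ioo_subset_Icc_self htm)] at ht
    linarith
  intro φ hφ hc hs hpos
  obtain ⟨C, hC⟩ := hc.exists_bound_of_continuous hφ.continuous
  have hψ : Continuous fun t => 2 * U t * φ t := (continuous_const.mul hU).mul hφ.continuous
  obtain ⟨C', hC'⟩ := (hc.mul_left (f := fun t => 2 * U t)).exists_bound_of_continuous hψ
  have l := (tendsto_integral_convolution_gammaPDFReal_mul hα.1 hvi hψ hC').sub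
    (tendsto_integral_convolution_gammaPDFReal_mul hα.1 hwi hφ.continuous hC)
  have hlim : (∫ t, (Ioo a b).indicator v t * (2 * U t * φ t))
      - (∫ t, (Ioo a b).indicator w t * φ t)
      = ∫ t in Ioo a b, (v t * (2 * U t) - w t) * φ t := by
    rw [← integral_sub (hvi.mul_bdd hψ.aestronglyMeasurable (Eventually.of_forall hC'))
      (hwi.mul_bdd hφ.continuous.aestronglyMeasurable (Eventually.of_forall hC)),
      ← integral_indicator measurableSet_Ioo]
    congr 1 with t
    by_cases h : t ∈ Ioo a b
    · simp only [indicator_of_mem h]; ring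
    · simp [h]
  rw [← hlim]
  refine ge_of_tendsto l ?_
  filter_upwards [eventually_gt_atTop 0] with n hn
  have hg := integrable_gammaPDFReal hα.1 hn
  rw [← integral_sub ((hg.integrable_convolution _ hvi).mul_bdd hψ.aestronglyMeasurable
      (Eventually.of_forall hC'))
    ((hg.integrable_convolution _ hwi).mul_bdd hφ.continuous.aestronglyMeasurable
      (Eventually.of_forall hC))]
  refine integral_nonneg_of_ae ?_
  filter_upwards [convolution_gammaPDFReal_weakDeriv_ae_eq hα hab hu hv hn,
    convolution_gammaPDFReal_weakDeriv_ae_eq hα hab hu2 hw hn] with t hvt hwt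
  by_cases h : t ∈ Ioo a b
  · simp only [Pi.zero_apply]
    rw [hvt h, hwt h, hUu t (Ioo_subset_Icc_self h)]
    have := mul_le_mul_of_nonneg_right (regularized_sq_le hα hab hu hn t) (hpos t)
    linarith
  · have : φ t = 0 := image_eq_zero_of_notMem_tsupport fun h' => h (hs h')
    simp [this]

theorem mainTheorem3 (α t₀ t₁ : ℝ) (hα : α ∈ Ioo (0 : ℝ) 1) (ht : t₀ < t₁)
    (f : ℝ → ℝ) (hf : ContinuousOn f (Icc t₀ t₁))
    (hW : MemW11 t₀ t₁ (kernelConv (1 - α) t₀ t₁ f))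
    (hW2 : MemW11 t₀ t₁ (kernelConv (1 - α) t₀ t₁ (fun t => f t ^ 2))) :
    HasWeakDerivL1 t₀ t₁ (kernelConv (1 - α) t₀ t₁ (fun t => f t - f t₀))
      (caputoDeriv α t₀ t₁ f) ∧
    HasWeakDerivL1 t₀ t₁ (kernelConv (1 - α) t₀ t₁ (fun t => f t ^ 2 - f t₀ ^ 2))
      (caputoDeriv α t₀ t₁ (fun t => f t ^ 2)) ∧
    ∀ᵐ t ∂(volume.restrict (Icc t₀ t₁)),
      caputoDeriv α t₀ t₁ (fun s => f s ^ 2) t ≤ 2 * caputoDeriv α t₀ t₁ f t * f t := by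
  have hα1 : 0 < 1 - α := sub_pos.2 hα.2
  have hsub : ∀ (g : ℝ → ℝ), ContinuousOn g (Icc t₀ t₁) →
      MemW11 t₀ t₁ (kernelConv (1 - α) t₀ t₁ g) → ∀ c : ℝ,
      MemW11 t₀ t₁ (kernelConv (1 - α) t₀ t₁ fun t => g t - c) := by
    rintro g hg ⟨v, hv⟩ c
    exact ⟨_, (hv.sub (hasWeakDerivL1_kernelConv_const hα1 ht c)).congr
      fun t h => kernelConv_sub hα1 hg continuousOn_const h.2⟩
  have h1 : HasWeakDerivL1 t₀ t₁ (kernelConv (1 - α) t₀ t₁ fun t => f t - f t₀)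
      (caputoDeriv α t₀ t₁ f) := (hsub f hf hW _).hasWeakDerivL1_weakDeriv
  have h2 : HasWeakDerivL1 t₀ t₁ (kernelConv (1 - α) t₀ t₁ fun t => f t ^ 2 - f t₀ ^ 2)
      (caputoDeriv α t₀ t₁ fun t => f t ^ 2) :=
    (hsub _ (hf.pow 2) hW2 _).hasWeakDerivL1_weakDeriv
  refine ⟨h1, h2, ?_⟩
  have hu : ContinuousOn (fun t => f t - f t₀) (Icc t₀ t₁) := hf.sub continuousOn_const
  -- By linearity, the inequality for `f - f t₀` has the term `-2 * f t₀` times the Caputo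
  -- derivative of `f` on both sides; it cancels.
  have hsq : (fun t => (f t - f t₀) ^ 2)
      = fun t => (f t ^ 2 - f t₀ ^ 2) - 2 * f t₀ * (f t - f t₀) := by
    ext t; ring
  have h3 : HasWeakDerivL1 t₀ t₁ (kernelConv (1 - α) t₀ t₁ fun t => (f t - f t₀) ^ 2)
      (fun t => caputoDeriv α t₀ t₁ (fun t => f t ^ 2) t
        - 2 * f t₀ * caputoDeriv α t₀ t₁ f t) := by
    rw [hsq]
    refine (h2.sub (h1.const_mul (2 * f t₀))).congr fun t h => ?_
    rw [kernelConv_sub (f := fun t => f t ^ 2 - f t₀ ^ 2) (g := fun t => 2 * f t₀ * (f t - f t₀))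
      hα1 ((hf.pow 2).sub continuousOn_const) (continuousOn_const.mul hu) h.2,
      kernelConv_const_mul]
  rw [← restrict_Ioo_eq_restrict_Icc]
  filter_upwards [weakDeriv_kernelConv_sq_le hα ht hu h1 h3] with t h
  linarith
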